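/- Let $\mathsf K$ be a Grothendieck category. A class of objects of $\mathsf K$ \emph{contains a set of generators} if it contains a set $\mathsf G$ of objects such that every object of $\mathsf K$ is a quotient of a coproduct of copies of objects from $\mathsf G$. An object $S\in\mathsf K$ is \emph{finitely generated} if $\operatorname{Hom}_{\mathsf K}(S,-)$ preserves the direct limits of diagrams of monomorphisms, and \emph{finitely presentable} if $\operatorname{Hom}_{\mathsf K}(S,-)$ preserves all direct limits. A class is \emph{closed under extensions} (respectively, \emph{under kernels of epimorphisms}) if for every short exact sequence $0\to X\to Y\to Z\to 0$ in $\mathsf K$ with $X$ and $Z$ (respectively, $Y$ and $Z$) in the class, the object $Y$ (respectively, $X$) also belongs to the class. For a class of objects $\mathsf S\subset\mathsf K$, let $\varinjlim\mathsf S$ denote the class of all direct limits in $\mathsf K$ of diagrams of objects from $\mathsf S$ indexed by nonempty directed posets. (1) Let $\mathsf S\subset\mathsf K$ be a nonempty class of finitely generated objects containing a set of generators of $\mathsf K$ and closed under extensions and kernels of epimorphisms. Then the class $\varinjlim\mathsf S$ is closed under coproducts, direct limits, extensions, and kernels of epimorphisms. (2) Let $\mathsf S\subset\mathsf K$ be a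 class of objects and $\mathsf T\subset\mathsf K$ a class of objects of finite projective dimension such that $\mathsf S\cup\mathsf T$ is nonempty and contains a set of generators of $\mathsf K$. Let $\mathsf C$ be the closure of $\mathsf S\cup\mathsf T$ under coproducts, direct limits, extensions, and kernels of epimorphisms, that is, the smallest class of objects of $\mathsf K$ which contains $\mathsf S\cup\mathsf T$ and is closed under these four operations. If $\mathsf S\cup\mathsf T$ consists of finitely presentable objects and is closed under extensions and kernels of epimorphisms in $\mathsf K$, then $\mathsf C=\varinjlim(\mathsf S\cup\mathsf T)$. -/

import Mathlib

open CategoryTheory CategoryTheory.Limits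

universe v u

namespace DirectLimitClasses

section

variable {K : Type u} [Category.{v} K]

/-- An object `X` is finitely generated if `Hom(X, -)` preserves the direct limits (indexed by
directed posets) of diagrams whose transition morphisms are monomorphisms. -/
def IsFinitelyGenerated (X : K) : Prop :=
  ∀ (I : Type v) [PartialOrder I] [IsDirectedOrder I] [Nonempty I] (F : I ⥤ K),
    (∀ {i j : I} (f : i ⟶ j), Mono (F.map f)) →
      PreservesColimit F (coyoneda.obj (Opposite.op X))

/-- A class of objects contains a set of generators: there is a (small) family of objects of the
class such that every object of the category is a quotient of a coproduct of copies of members of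
the family. -/
def ContainsSetOfGenerators (S : ObjectProperty K) [HasCoproducts.{v} K] : Prop :=
  ∃ (ι : Type v) (G : ι → K), (∀ i, S (G i)) ∧
    ∀ X : K, ∃ (A : Type v) (c : A → ι) (p : (∐ fun a => G (c a)) ⟶ X), Epi p

/-- The class of all direct limits of diagrams of objects from `S` indexed by (nonempty) directed
posets. -/
def directLimits (S : ObjectProperty K) : ObjectProperty K := fun X =>
  ∃ (I : Type v) (_ : PartialOrder I) (_ : IsDirectedOrder I) (_ : Nonempty I),
    S.colimitsOfShape I X

/-- Closure under coproducts of arbitrary small families, the empty family included. -/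
def ClosedUnderCoproducts (S : ObjectProperty K) : Prop :=
  ∀ I : Type v, S.IsClosedUnderColimitsOfShape (Discrete I)

/-- Closure under direct limits of diagrams indexed by (nonempty) directed posets. -/
def ClosedUnderDirectLimits (S : ObjectProperty K) : Prop :=
  ∀ (I : Type v) [PartialOrder I] [IsDirectedOrder I] [Nonempty I],
    S.IsClosedUnderColimitsOfShape I

/-- Closure under kernels of epimorphisms: in every short exact sequence
`0 ⟶ X₁ ⟶ X₂ ⟶ X₃ ⟶ 0`, if `X₂` and `X₃` are in the class, then so is `X₁`. -/
def ClosedUnderKernelsOfEpis [HasZeroMorphisms K] (S : ObjectProperty K) : Prop :=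
  ∀ ⦃E : ShortComplex K⦄, E.ShortExact → S E.X₂ → S E.X₃ → S E.X₁

/-- Closure under coproducts, direct limits, extensions, and kernels of epimorphisms. -/
structure IsFullyClosed [HasZeroMorphisms K] (S : ObjectProperty K) : Prop where
  coproducts : ClosedUnderCoproducts S
  directLimits : ClosedUnderDirectLimits S
  extensions : S.IsClosedUnderExtensions
  kernelsOfEpis : ClosedUnderKernelsOfEpis S

/-- The closure of a class of objects under coproducts, direct limits, extensions, and kernels of
epimorphisms, that is, the smallest class which contains it and is closed in this sense. -/
def fullClosure [HasZeroMorphisms K] (S : ObjectProperty K) : ObjectProperty K := fun X =>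
  ∀ P : ObjectProperty K, S ≤ P → IsFullyClosed P → P X

end

end DirectLimitClasses

open DirectLimitClasses

/-!
Let `S` be a class of finitely generated objects as in the first part. An epimorphism from an object
of `S` to an object of `S` has a finitely generated kernel, because this kernel is again in `S`.
Since `S` contains generators, every finitely generated object is a quotient of an object of `S`, and
together these facts make the objects of `S` finitely presentable
(`IsFGResolving.isFinitelyPresentable`).

The class of direct limits then has an elementary description
(`IsFGResolving.directLimits_eq`): an object `X` is a direct limit of objects of `S` if and only if,
whenever `S₁ ⟶ S₀ ⟶ X` is zero with `S₁` and `S₀` in `S`, the second morphism factors as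
`S₀ ⟶ S' ⟶ X` with `S'` in `S` and `S₁ ⟶ S₀ ⟶ S'` zero. This condition makes the comma category of
`S` over `X` filtered, and its colimit is then `X`; the comma category is essentially small because
finitely presentable objects are.

The condition is visibly stable under direct limits. For extensions and kernels of epimorphisms it is
verified by a diagram chase: relations are first factored over one end of the sequence, the
resulting morphism in `S` is made epimorphic by adding a summand from `S`, and its kernel, which is
in `S`, is used at the other end
(`IsFGResolving.factorsRelations_X₂`, `IsFGResolving.factorsRelations_X₁`). Coproducts are direct
limits of finite coproducts.

For the second part, the class of direct limits is thus closed under the four operations, and it is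
contained in every class which contains `S` and is closed under direct limits.
-/

namespace DirectLimitClasses

lemma isFinitelyGenerated_of_isFinitelyPresentable {K : Type u} [Category.{v} K]
    {X : K} (hX : IsFinitelyPresentable.{v} X) :
    IsFinitelyGenerated X := by
  intro I _ _ _ F _
  infer_instance

variable {K : Type u} [Category.{v} K] [Abelian K]

/-! ### Short exact sequences -/

/-- The zero object is the kernel of the identity of any object of the class. -/
lemma containsZero_of_closedUnderKernelsOfEpis {S : ObjectProperty K} (hne : S.Nonempty)
    (hS : ClosedUnderKernelsOfEpis S) : S.ContainsZero := by
  obtain ⟨X, hX⟩ := hne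
  open scoped ZeroObject in
  have h : (ShortComplex.mk (0 : (0 : K) ⟶ X) (𝟙 X) zero_comp).ShortExact :=
    { exact := (ShortComplex.exact_iff_mono _ (by rfl)).2 (by dsimp; infer_instance)
      mono_f := by dsimp; infer_instance
      epi_g := by dsimp; infer_instance }
  exact ⟨_, isZero_zero K, hS h hX hX⟩

/-- An isomorphism is an extension by a zero object. -/
lemma isClosedUnderIsomorphisms_of_isClosedUnderExtensions (S : ObjectProperty K)
    [S.ContainsZero] [S.IsClosedUnderExtensions] : S.IsClosedUnderIsomorphisms where
  of_iso {X Y} e hX := by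
    obtain ⟨Z, hZ, hSZ⟩ := S.exists_prop_of_containsZero
    have h : (ShortComplex.mk e.hom (0 : Y ⟶ Z) comp_zero).ShortExact :=
      { exact := (ShortComplex.exact_iff_epi _ (by rfl)).2 (by dsimp; infer_instance)
        mono_f := by dsimp; infer_instance
        epi_g := ⟨fun _ _ _ ↦ hZ.eq_of_src _ _⟩ }
    exact S.prop_X₂_of_shortExact h hX hSZ

lemma shortExact_kernel {X Y : K} (p : X ⟶ Y) [Epi p] :
    (ShortComplex.mk (kernel.ι p) p (kernel.condition p)).ShortExact :=
  { exact := ShortComplex.exact_of_f_is_kernel _ (kernelIsKernel p)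
    mono_f := by dsimp; infer_instance
    epi_g := by dsimp; infer_instance }

/-- The pushout of an extension of `E.X₃` by `E.X₁` along `h : E.X₁ ⟶ B` is an extension of
`E.X₃` by `B`. -/
lemma shortExact_pushout {E : ShortComplex K} (hE : E.ShortExact) {B : K} (h : E.X₁ ⟶ B) :
    (ShortComplex.mk (pushout.inr E.f h) (pushout.desc E.g (0 : B ⟶ E.X₃) (by simp))
      (pushout.inr_desc _ _ _)).ShortExact := by
  have := hE.mono_f
  have := hE.epi_g
  have hdesc : pushout.inl E.f h ≫ pushout.desc E.g (0 : B ⟶ E.X₃) (by simp) = E.g :=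
    pushout.inl_desc _ _ _
  have hepi := epi_of_epi_fac hdesc
  refine { exact := ?_, mono_f := by dsimp; infer_instance, epi_g := hepi }
  refine ShortComplex.exact_of_g_is_cokernel _ (CokernelCofork.IsColimit.ofπ' _ _
    fun {Z} (x : pushout E.f h ⟶ Z) (hx : pushout.inr E.f h ≫ x = 0) ↦ ?_)
  have hx' : E.f ≫ pushout.inl E.f h ≫ x = 0 := by
    rw [pushout.condition_assoc, hx, comp_zero]
  refine ⟨hE.exact.desc _ hx', pushout.hom_ext ?_ ?_⟩
  · rw [pushout.inl_desc_assoc, hE.exact.g_desc]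
  · rw [pushout.inr_desc_assoc, zero_comp, hx]

/-! ### Factorization of relations -/

/-- The objects `X` such that every morphism `S₀ ⟶ X` which kills some `S₁ ⟶ S₀`, where `S₁` and `S₀`
belong to `S`, factors through a morphism from `S₀` to an object of `S` which already kills
`S₁ ⟶ S₀`. Equivalently, every morphism to `X` from the cokernel of a morphism between
objects of `S` factors through an object of `S`. -/
def FactorsRelations (S : ObjectProperty K) : ObjectProperty K := fun X =>
  ∀ ⦃S₁ S₀ : K⦄, S S₁ → S S₀ → ∀ (f : S₁ ⟶ S₀) (g : S₀ ⟶ X), f ≫ g = 0 →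
    ∃ (S' : K) (_ : S S') (h : S₀ ⟶ S') (k : S' ⟶ X), h ≫ k = g ∧ f ≫ h = 0

lemma factorsRelations_of_prop {S : ObjectProperty K} {X : K} (hX : S X) :
    FactorsRelations S X :=
  fun _ _ _ _ _ g hfg ↦ ⟨X, hX, g, 𝟙 X, Category.comp_id g, hfg⟩

/-- A morphism `f : Y ⟶ X` from an object of `S`, as an object of the comma category of `S` over
`X`. -/
abbrev costructuredArrowMk {S : ObjectProperty K} {X Y : K} (hY : S Y) (f : Y ⟶ X) :
    CostructuredArrow S.ι X :=
  CostructuredArrow.mk (S := S.ι) (Y := (⟨Y, hY⟩ : S.FullSubcategory)) f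

variable [IsGrothendieckAbelian.{v} K]

/-! ### Finitely generated objects -/

/-- A finitely generated object is not the union of a filtered family of proper subobjects. The
index category is an arbitrary small filtered category, reached from directed posets by a final
functor. -/
lemma IsFinitelyGenerated.exists_isIso_monoOver {X : K} (hX : IsFinitelyGenerated X)
    {J : Type v} [SmallCategory J] [IsFiltered J] (F : J ⥤ MonoOver X)
    {c : Cocone (F ⋙ MonoOver.forget _ ⋙ Over.forget _)} (hc : IsColimit c)
    (f : c.pt ⟶ X) (hf : ∀ j, c.ι.app j ≫ f = (F.obj j).obj.hom) [Epi f] :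
    ∃ j, IsIso (F.obj j).obj.hom := by
  have := IsGrothendieckAbelian.mono_of_isColimit_monoOver F hc f hf
  have : IsIso f := isIso_of_mono_of_epi f
  obtain ⟨I, _, _, _, G, _⟩ := IsFiltered.exists_directed J
  let D := G ⋙ F ⋙ MonoOver.forget X ⋙ Over.forget X
  have hD : ∀ {i j : I} (φ : i ⟶ j), Mono (D.map φ) := fun {i j} φ ↦ by
    have : Mono (D.map φ ≫ (F.obj (G.obj j)).obj.hom) := by
      have : D.map φ ≫ (F.obj (G.obj j)).obj.hom = (F.obj (G.obj i)).obj.hom :=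
        Over.w ((F.map (G.map φ)).hom)
      rw [this]
      exact (F.obj (G.obj i)).property
    exact mono_of_mono _ (F.obj (G.obj j)).obj.hom
  have := hX I D hD
  have hc' : IsColimit (c.whisker G) := (Functor.Final.isColimitWhiskerEquiv G c).symm hc
  obtain ⟨i, y, hy⟩ := Types.jointly_surjective_of_isColimit
    (isColimitOfPreserves (coyoneda.obj (Opposite.op X)) hc') (inv f)
  replace hy : y ≫ c.ι.app (G.obj i) = inv f := hy
  refine ⟨G.obj i, ?_⟩
  have hs : y ≫ (F.obj (G.obj i)).obj.hom = 𝟙 X := by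
    rw [← hf, reassoc_of% hy, IsIso.inv_hom_id]
  have : Mono (F.obj (G.obj i)).obj.hom := (F.obj (G.obj i)).property
  have : IsSplitEpi (F.obj (G.obj i)).obj.hom := ⟨⟨y, hs⟩⟩
  exact isIso_of_mono_of_isSplitEpi _

/-- `Hom(X, -)` is injective on filtered colimits if `X` is finitely generated: by AB5, `X` is the
union of the kernels of the composites of `y` with the transition morphisms. -/
lemma IsFinitelyGenerated.exists_map_eq_zero {X : K} (hX : IsFinitelyGenerated X)
    {J : Type v} [SmallCategory J] [IsFiltered J] {D : J ⥤ K} {c : Cocone D} (hc : IsColimit c)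
    {j₀ : J} (y : X ⟶ D.obj j₀) (hy : y ≫ c.ι.app j₀ = 0) :
    ∃ (j : J) (φ : j₀ ⟶ j), y ≫ D.map φ = 0 := by
  have := IsGrothendieckAbelian.IsPresentable.injectivity₀.epi_f hc hy
  obtain ⟨j, h⟩ := hX.exists_isIso_monoOver
    (IsGrothendieckAbelian.IsPresentable.injectivity₀.F y)
    (colimit.isColimit (kernel (IsGrothendieckAbelian.IsPresentable.injectivity₀.g y)))
    (IsGrothendieckAbelian.IsPresentable.injectivity₀.f y)
    (fun j ↦ by simpa using! IsGrothendieckAbelian.IsPresentable.injectivity₀.hf y j)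
  have : IsIso ((kernel.ι
      (IsGrothendieckAbelian.IsPresentable.injectivity₀.g y)).app j) := h
  refine ⟨j.right, j.hom, ?_⟩
  simpa only [← cancel_epi ((kernel.ι
      (IsGrothendieckAbelian.IsPresentable.injectivity₀.g y)).app j), comp_zero]
    using! NatTrans.congr_app
      (kernel.condition (IsGrothendieckAbelian.IsPresentable.injectivity₀.g y)) j

/-- If a filtered colimit maps epimorphically onto a finitely generated object, then so does some
term of the diagram: the images of the terms form a filtered family of subobjects. -/
lemma IsFinitelyGenerated.exists_epi {X : K} (hX : IsFinitelyGenerated X)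
    {J : Type v} [SmallCategory J] [IsFiltered J] {D : J ⥤ K} {c : Cocone D} (hc : IsColimit c)
    (p : c.pt ⟶ X) (hp : Epi p) : ∃ j, Epi (c.ι.app j ≫ p) := by
  let F : J ⥤ MonoOver X :=
    { obj j := MonoOver.mk (image.ι (c.ι.app j ≫ p))
      map {j j'} φ := MonoOver.homMk (image.lift
        { I := image (c.ι.app j' ≫ p)
          m := image.ι _
          e := D.map φ ≫ factorThruImage (c.ι.app j' ≫ p)
          fac := by simp }) (image.lift_fac _) }
  let d : Cocone (F ⋙ MonoOver.forget _ ⋙ Over.forget _) :=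
    { pt := X
      ι := { app j := image.ι (c.ι.app j ≫ p)
             naturality j j' φ :=
               (Over.w (F.map φ).hom).trans (Category.comp_id _).symm } }
  let q : colimit (F ⋙ MonoOver.forget _ ⋙ Over.forget _) ⟶ X := colimit.desc _ d
  have hq : ∀ j, colimit.ι (F ⋙ MonoOver.forget _ ⋙ Over.forget _) j ≫ q =
      image.ι (c.ι.app j ≫ p) := fun j ↦ colimit.ι_desc d j
  have : Epi q := by
    refine ⟨fun {Z} a b hab ↦ ?_⟩
    rw [← cancel_epi p]
    refine hc.hom_ext fun j ↦ ?_
    have hq' (u : X ⟶ Z) : image.ι (c.ι.app j ≫ p) ≫ u = colimit.ι _ j ≫ q ≫ u :=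
      (congrArg (· ≫ u) (hq j).symm).trans (Category.assoc _ _ _)
    have h : image.ι (c.ι.app j ≫ p) ≫ a = image.ι (c.ι.app j ≫ p) ≫ b := by
      rw [hq', hq', hab]
    have := factorThruImage (c.ι.app j ≫ p) ≫= h
    simpa using this
  obtain ⟨j, hj⟩ := hX.exists_isIso_monoOver F (colimit.isColimit _) q hq
  refine ⟨j, ?_⟩
  have : IsIso (image.ι (c.ι.app j ≫ p)) := hj
  rw [← image.fac (c.ι.app j ≫ p)]
  exact epi_comp _ _

lemma prop_sigma_of_finite (P : ObjectProperty K) [P.ContainsZero] [P.IsClosedUnderIsomorphisms]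
    [P.IsClosedUnderExtensions] {α : Type v} [Finite α] (f : α → K) (hf : ∀ a, P (f a)) :
    P (∐ f) := by
  have : P.IsClosedUnderBinaryCoproducts := .mk' (by
    rintro _ ⟨F, hF⟩
    exact P.prop_of_iso (HasColimit.isoOfNatIso (diagramIsoPair F) ≪≫
      (biprod.isoCoprod _ _).symm).symm (P.prop_biprod (hF _) (hF _)))
  have : P.IsClosedUnderFiniteCoproducts := .mk'
  exact P.prop_coproduct hf

/-! ### Finite presentability -/

/-- The hypotheses on `S` under which its direct limits are studied: a nonempty class of finitely
generated objects, containing a set of generators and closed under extensions and kernels of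
epimorphisms. -/
structure IsFGResolving (S : ObjectProperty K) : Prop where
  nonempty : S.Nonempty
  fg : ∀ X, S X → IsFinitelyGenerated X
  generators : ContainsSetOfGenerators S
  extensions : S.IsClosedUnderExtensions
  kernels : ClosedUnderKernelsOfEpis S

namespace IsFGResolving

variable {S : ObjectProperty K} (hS : IsFGResolving S)
include hS

lemma containsZero : S.ContainsZero :=
  containsZero_of_closedUnderKernelsOfEpis hS.nonempty hS.kernels

lemma isClosedUnderIsomorphisms : S.IsClosedUnderIsomorphisms := by
  have := hS.containsZero
  have := hS.extensions
  exact isClosedUnderIsomorphisms_of_isClosedUnderExtensions S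

lemma prop_kernel {X Y : K} (p : X ⟶ Y) [Epi p] (hX : S X) (hY : S Y) : S (kernel p) :=
  hS.kernels (shortExact_kernel p) hX hY

lemma prop_biprod {X Y : K} (hX : S X) (hY : S Y) : S (X ⊞ Y) := by
  have := hS.extensions
  exact S.prop_biprod hX hY

/-- An epimorphism onto a finitely generated object restricts to an epimorphism from an object of
`S`, namely from a finite coproduct of generators. -/
lemma exists_epi_comp {X Y : K} (hX : IsFinitelyGenerated X) (p : Y ⟶ X) [Epi p] :
    ∃ (T : K) (_ : S T) (t : T ⟶ Y), Epi (t ≫ p) := by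
  have := hS.containsZero
  have := hS.isClosedUnderIsomorphisms
  have := hS.extensions
  obtain ⟨ι, G, hG, h⟩ := hS.generators
  obtain ⟨A, c, q, _⟩ := h Y
  obtain ⟨s, hs⟩ := hX.exists_epi
    (CoproductsFromFiniteFiltered.isColimitFiniteSubproductsCocone fun a ↦ G (c a)) (q ≫ p)
    (epi_comp q p)
  let t : (∐ fun x : s ↦ G (c x.1.as)) ⟶ ∐ fun a ↦ G (c a) :=
    (CoproductsFromFiniteFiltered.finiteSubcoproductsCocone fun a ↦ G (c a)).ι.app s
  refine ⟨_, prop_sigma_of_finite S _ fun x : s ↦ hG (c x.1.as), t ≫ q, ?_⟩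
  rw [Category.assoc]
  exact hs

/-- A morphism from a finitely generated object lifts along an epimorphism after it is precomposed
with an epimorphism from an object of `S`. -/
lemma exists_refinement {X Y Z : K} (hX : IsFinitelyGenerated X) (p : Y ⟶ Z) [Epi p]
    (s : X ⟶ Z) :
    ∃ (T : K) (_ : S T) (π : T ⟶ X) (_ : Epi π) (t : T ⟶ Y), π ≫ s = t ≫ p := by
  obtain ⟨T, hT, t, ht⟩ := hS.exists_epi_comp hX (pullback.snd p s)
  exact ⟨T, hT, t ≫ pullback.snd p s, ht, t ≫ pullback.fst p s, by
    simp [pullback.condition]⟩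

/-- `Hom(X, -)` is surjective on filtered colimits for `X` in `S`. The pullback of `z` to some term
`D.obj j` is epimorphic over `X`, hence so is an object `T` of `S` mapping to it. The kernel of
`T ⟶ X` is in `S`, hence finitely generated, so `T ⟶ D.obj j` descends to `X` at a later term. -/
lemma exists_hom_of_isColimit {X : K} (hX : S X) {J : Type v} [SmallCategory J] [IsFiltered J]
    {D : J ⥤ K} {c : Cocone D} (hc : IsColimit c) (z : X ⟶ c.pt) :
    ∃ (j : J) (y : X ⟶ D.obj j), z = y ≫ c.ι.app j := by
  have := IsGrothendieckAbelian.IsPresentable.surjectivity.epi_f hc z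
  obtain ⟨j, hj⟩ := (hS.fg X hX).exists_epi (colimit.isColimit _)
    (IsGrothendieckAbelian.IsPresentable.surjectivity.f z) this
  have hj' : Epi ((pullback.snd c.ι ((Functor.const _).map z)).app j) := by
    rw [← IsGrothendieckAbelian.IsPresentable.surjectivity.hf z j]
    exact hj
  obtain ⟨T, hT, t, ht⟩ := hS.exists_epi_comp (hS.fg X hX)
    ((pullback.snd c.ι ((Functor.const _).map z)).app j)
  let π : T ⟶ X := t ≫ (pullback.snd c.ι ((Functor.const _).map z)).app j
  let w : T ⟶ D.obj j := t ≫ (pullback.fst c.ι ((Functor.const _).map z)).app j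
  have hw : w ≫ c.ι.app j = π ≫ z := by
    have := NatTrans.congr_app (pullback.condition (f := c.ι) (g := (Functor.const _).map z)) j
    simpa [w, π] using! t ≫= this
  have hπ : Epi π := ht
  obtain ⟨j', φ, hφ⟩ := (hS.fg _ (hS.prop_kernel π hT hX)).exists_map_eq_zero hc
    (kernel.ι π ≫ w) (by simp [hw])
  rw [Category.assoc] at hφ
  let e := (shortExact_kernel π).gIsCokernel
  refine ⟨j', e.desc (CokernelCofork.ofπ _ hφ), ?_⟩
  have h : π ≫ e.desc (CokernelCofork.ofπ _ hφ) = w ≫ D.map φ :=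
    e.fac _ WalkingParallelPair.one
  rw [← cancel_epi π, reassoc_of% h, c.w, hw]

lemma isFinitelyPresentable {X : K} (hX : S X) : IsFinitelyPresentable.{v} X := by
  rw [isFinitelyPresentable_iff_preservesFilteredColimits]
  refine ⟨fun J _ _ ↦ ⟨fun {D} ↦ ⟨fun {c} hc ↦ ⟨?_⟩⟩⟩⟩
  refine Types.FilteredColimit.isColimitOf' _ _ (hS.exists_hom_of_isColimit hX hc)
    fun i (x y : X ⟶ D.obj i) hxy ↦ ?_
  obtain ⟨j, φ, hφ⟩ := (hS.fg X hX).exists_map_eq_zero hc (x - y) (by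
    rw [Preadditive.sub_comp, sub_eq_zero]
    exact hxy)
  rw [Preadditive.sub_comp, sub_eq_zero] at hφ
  exact ⟨j, φ, hφ⟩

/-- The generators in `S` are finitely presentable, so `K` is locally finitely presentable. -/
lemma isFinitelyAccessibleCategory : IsFinitelyAccessibleCategory.{v} K := by
  suffices IsLocallyFinitelyPresentable.{v} K by infer_instance
  obtain ⟨ι, G, hG, h⟩ := hS.generators
  have := Cardinal.fact_isRegular_aleph0
  refine (IsCardinalLocallyPresentable.iff_exists_isStrongGenerator K _).2
    ⟨.ofObj G, inferInstance, .mk_of_exists_extremalEpi.{v} fun X ↦ ?_, ?_⟩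
  · obtain ⟨A, c, p, _⟩ := h X
    have : ExtremalEpi p :=
      { isIso _ i fac _ := by
          have := epi_of_epi_fac fac
          exact isIso_of_mono_of_epi i }
    exact ⟨A, fun a ↦ G (c a), fun a ↦ ⟨c a⟩, _, coproductIsCoproduct _, p, this⟩
  · rintro _ ⟨i⟩
    exact hS.isFinitelyPresentable (hG i)

lemma essentiallySmall : ObjectProperty.EssentiallySmall.{v} S := by
  have := hS.isFinitelyAccessibleCategory
  exact .of_le (Q := ObjectProperty.isFinitelyPresentable.{v} K)
    fun X hX ↦ hS.isFinitelyPresentable hX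

/-! ### Direct limits as factorization of relations -/

/-- In the comma category of `S` over `X`, two objects map to their biproduct, and two parallel
morphisms are made equal by factoring the relation given by their difference. -/
lemma isFiltered_costructuredArrow {X : K} (hX : FactorsRelations S X) :
    IsFiltered (CostructuredArrow S.ι X) where
  nonempty := by
    obtain ⟨Z, -, hZ⟩ := hS.containsZero.exists_zero
    exact ⟨costructuredArrowMk hZ (0 : Z ⟶ X)⟩
  cocone_objs a b :=
    ⟨costructuredArrowMk (hS.prop_biprod a.left.2 b.left.2) (biprod.desc a.hom b.hom),
      CostructuredArrow.homMk (ObjectProperty.homMk biprod.inl) (biprod.inl_desc a.hom b.hom),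
      CostructuredArrow.homMk (ObjectProperty.homMk biprod.inr) (biprod.inr_desc a.hom b.hom),
      trivial⟩
  cocone_maps a b u v := by
    have hu : u.left.hom ≫ b.hom = a.hom := CostructuredArrow.w u
    have hv : v.left.hom ≫ b.hom = a.hom := CostructuredArrow.w v
    obtain ⟨S', hS', h, k, hk, hh⟩ := hX a.left.2 b.left.2 (u.left.hom - v.left.hom) b.hom
      (by rw [Preadditive.sub_comp, hu, hv, sub_self])
    rw [Preadditive.sub_comp, sub_eq_zero] at hh
    refine ⟨costructuredArrowMk hS' k,
      CostructuredArrow.homMk (ObjectProperty.homMk h) hk, ?_⟩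
    ext
    exact hh

/-- If `X` factors relations, then it is the filtered colimit of all objects of `S` over `X`. The
comparison morphism `q` from the colimit is tested on generators belonging to `S`. -/
lemma directLimits_of_factorsRelations {X : K} (hX : FactorsRelations S X) :
    directLimits S X := by
  have := hS.isFiltered_costructuredArrow hX
  have := hS.essentiallySmall
  let e := equivSmallModel.{v} (CostructuredArrow S.ι X)
  let E := e.inverse
  have : IsFiltered (SmallModel.{v} (CostructuredArrow S.ι X)) := .of_equivalence e
  let D := E ⋙ CostructuredArrow.proj S.ι X ⋙ S.ι
  let g (j) : D.obj j ⟶ X := (E.obj j).hom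
  have hlift {Y : K} (hY : S Y) (f : Y ⟶ X) :
      ∃ (j : _) (m : Y ⟶ D.obj j), m ≫ g j = f := by
    let m := e.unitIso.hom.app (costructuredArrowMk hY f)
    exact ⟨_, m.left.hom, CostructuredArrow.w m⟩
  have hmap {j} {Y : K} (hY : S Y) (k : D.obj j ⟶ Y) (f : Y ⟶ X) (hk : k ≫ f = g j) :
      ∃ (j' : _) (φ : j ⟶ j') (m : Y ⟶ D.obj j'), D.map φ = k ≫ m := by
    let m := e.unitIso.hom.app (costructuredArrowMk hY f)
    let n : E.obj j ⟶ costructuredArrowMk hY f :=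
      CostructuredArrow.homMk (ObjectProperty.homMk k) hk
    refine ⟨_, E.preimage (n ≫ m), m.left.hom, ?_⟩
    change (E.map (E.preimage (n ≫ m))).left.hom = _
    rw [E.map_preimage]
    rfl
  let d : Cocone D :=
    { pt := X
      ι := { app := g
             naturality j j' φ :=
               (CostructuredArrow.w (E.map φ)).trans (Category.comp_id _).symm } }
  let q : colimit D ⟶ X := colimit.desc D d
  have hq (j) : colimit.ι D j ≫ q = g j := colimit.ι_desc d j
  obtain ⟨ι, G, hG, hcover⟩ := hS.generators
  -- Each component of a cover of `X` by generators is itself a term of the diagram.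
  have : Epi q := by
    obtain ⟨A, c, p, _⟩ := hcover X
    refine ⟨fun {Z} u w huw ↦ ?_⟩
    rw [← cancel_epi p]
    refine Sigma.hom_ext _ _ fun a ↦ ?_
    obtain ⟨j, m, hm⟩ := hlift (hG (c a)) (Sigma.ι (fun a ↦ G (c a)) a ≫ p)
    rw [← Category.assoc, ← Category.assoc, ← hm, ← hq]
    simp only [Category.assoc, huw]
  -- A generator mapping to the kernel of `q` factors through some term of the diagram, and the
  -- relation it gives there is killed at a later term.
  have : Mono q := by
    refine Preadditive.mono_of_cancel_zero _ fun {Z} t ht ↦ ?_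
    obtain ⟨A, c, p, _⟩ := hcover Z
    rw [← cancel_epi p, comp_zero]
    refine Sigma.hom_ext _ _ fun a ↦ ?_
    rw [comp_zero]
    obtain ⟨j, y, hy⟩ := hS.exists_hom_of_isColimit (hG (c a)) (colimit.isColimit D)
      (Sigma.ι (fun a ↦ G (c a)) a ≫ p ≫ t)
    replace hy : Sigma.ι (fun a ↦ G (c a)) a ≫ p ≫ t = y ≫ colimit.ι D j := hy
    have hy₀ : y ≫ g j = 0 := by
      rw [← hq, ← Category.assoc, ← hy, Category.assoc, Category.assoc, ht, comp_zero, comp_zero]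
    obtain ⟨S', hS', k, k', hk, hk₀⟩ := hX (S₀ := D.obj j) (hG (c a)) (E.obj j).left.2
      y (g j) hy₀
    obtain ⟨j', φ, m, hφ⟩ := hmap hS' k k' hk
    rw [hy, ← colimit.w D φ, hφ, Category.assoc, reassoc_of% hk₀, zero_comp]
  have : IsIso q := isIso_of_mono_of_epi q
  obtain ⟨I, _, _, _, G, _⟩ := IsFiltered.exists_directed
    (SmallModel.{v} (CostructuredArrow S.ι X))
  exact ⟨I, _, ‹_›, ‹_›,
    ⟨((ObjectProperty.ColimitOfShape.colimit D fun j ↦ (E.obj j).left.2).ofIso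
      (asIso q)).reindex G⟩⟩

lemma factorsRelations_of_isColimit {J : Type v} [SmallCategory J] [IsFiltered J] {D : J ⥤ K}
    {c : Cocone D} (hc : IsColimit c) (hD : ∀ j, FactorsRelations S (D.obj j)) :
    FactorsRelations S c.pt := by
  intro S₁ S₀ h₁ h₀ f g hfg
  obtain ⟨j, y, rfl⟩ := hS.exists_hom_of_isColimit h₀ hc g
  obtain ⟨j', φ, hφ⟩ := (hS.fg _ h₁).exists_map_eq_zero hc (f ≫ y) (by simpa using hfg)
  obtain ⟨S', hS', h, k, hk, hh⟩ := hD j' h₁ h₀ f (y ≫ D.map φ) (by simpa using hφ)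
  exact ⟨S', hS', h, k ≫ c.ι.app j', by simp [reassoc_of% hk], hh⟩

/-- For `S` as above, the direct limits of objects of `S` are the objects that factor relations. -/
lemma directLimits_eq : directLimits S = FactorsRelations S := by
  refine le_antisymm ?_ fun X hX ↦ hS.directLimits_of_factorsRelations hX
  rintro X ⟨I, _, _, _, ⟨p⟩⟩
  exact hS.factorsRelations_of_isColimit p.isColimit
    fun i ↦ factorsRelations_of_prop (p.prop_diag_obj i)

/-! ### Closure properties -/

lemma closedUnderDirectLimits : ClosedUnderDirectLimits (directLimits S) := by
  rw [hS.directLimits_eq]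
  intro I _ _ _
  exact ⟨by
    rintro X ⟨p⟩
    exact hS.factorsRelations_of_isColimit p.isColimit p.prop_diag_obj⟩

/-- Factoring the relation over `E.X₃` gives `a : S₀ ⟶ S'`. Enlarging `S₀` by an object `T` of `S`
makes `a` an epimorphism `p`, whose kernel lies in `S` and maps to `E.X₁`. The relation factors
through this kernel, so it can be killed by a morphism `h` from the kernel to an object of `S` over
`E.X₁`, and the pushout of the extension `p` along `h` is the object required. -/
lemma factorsRelations_X₂ {E : ShortComplex K} (hE : E.ShortExact)
    (h₁ : FactorsRelations S E.X₁) (h₃ : FactorsRelations S E.X₃) : FactorsRelations S E.X₂ := by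
  intro S₁ S₀ hS₁ hS₀ f g hfg
  have := hE.mono_f
  have := hE.epi_g
  obtain ⟨S', hS', a, b, hab, hfa⟩ := h₃ hS₁ hS₀ f (g ≫ E.g) (by rw [reassoc_of% hfg, zero_comp])
  obtain ⟨T, hT, π, _, t, ht⟩ := hS.exists_refinement (hS.fg S' hS') E.g b
  let p : S₀ ⊞ T ⟶ S' := biprod.desc a π
  let r : S₀ ⊞ T ⟶ E.X₂ := biprod.desc g t
  have hpr : r ≫ E.g = p ≫ b := by
    ext
    · simp [p, r, hab]
    · simp [p, r, ht]
  have : Epi p := epi_of_epi_fac (biprod.inr_desc a π)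
  have hker : S (kernel p) := hS.prop_kernel p (hS.prop_biprod hS₀ hT) hS'
  have hr : (kernel.ι p ≫ r) ≫ E.g = 0 := by
    rw [Category.assoc, hpr, kernel.condition_assoc, zero_comp]
  obtain ⟨s, hs⟩ : ∃ s : kernel p ⟶ E.X₁, s ≫ E.f = kernel.ι p ≫ r :=
    ⟨hE.exact.lift _ hr, hE.exact.lift_f _ hr⟩
  obtain ⟨l, hl⟩ : ∃ l : S₁ ⟶ kernel p, l ≫ kernel.ι p = f ≫ biprod.inl :=
    ⟨kernel.lift p (f ≫ biprod.inl) (by simp [p, hfa]), kernel.lift_ι _ _ _⟩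
  have hls : l ≫ s = 0 := by
    rw [← cancel_mono E.f, Category.assoc, hs, reassoc_of% hl]
    simp [r, hfg]
  obtain ⟨S'', hS'', h, k, hk, hlh⟩ := h₁ hS₁ hker l s hls
  have hE' := shortExact_pushout (shortExact_kernel p) h
  have := hS.extensions
  refine ⟨_, S.prop_X₂_of_shortExact hE' hS'' hS', biprod.inl ≫ pushout.inl (kernel.ι p) h,
    pushout.desc r (k ≫ E.f) (by rw [reassoc_of% hk, hs]),
    by rw [Category.assoc, pushout.inl_desc, biprod.inl_desc], ?_⟩
  rw [← Category.assoc, ← hl, Category.assoc, pushout.condition, reassoc_of% hlh, zero_comp]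

/-- Factoring the relation over `E.X₂` gives `a : S₀ ⟶ S'`, which composes to zero with the morphism
to `E.X₃`. Factoring this second relation gives `c : S' ⟶ S''` over `E.X₃`, which becomes an
epimorphism `p` after `S'` is enlarged by an object of `S`. The object required is the kernel of
`p`. -/
lemma factorsRelations_X₁ {E : ShortComplex K} (hE : E.ShortExact)
    (h₂ : FactorsRelations S E.X₂) (h₃ : FactorsRelations S E.X₃) : FactorsRelations S E.X₁ := by
  intro S₁ S₀ hS₁ hS₀ f g hfg
  have := hE.mono_f
  have := hE.epi_g
  obtain ⟨S', hS', a, b, hab, hfa⟩ := h₂ hS₁ hS₀ f (g ≫ E.f) (by rw [reassoc_of% hfg, zero_comp])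
  obtain ⟨S'', hS'', c, d, hcd, hac⟩ := h₃ hS₀ hS' a (b ≫ E.g)
    (by rw [reassoc_of% hab, E.zero, comp_zero])
  obtain ⟨T, hT, π, _, t, ht⟩ := hS.exists_refinement (hS.fg S'' hS'') E.g d
  let p : S' ⊞ T ⟶ S'' := biprod.desc c π
  let r : S' ⊞ T ⟶ E.X₂ := biprod.desc b t
  have hpr : r ≫ E.g = p ≫ d := by
    ext
    · simp [p, r, hcd]
    · simp [p, r, ht]
  have : Epi p := epi_of_epi_fac (biprod.inr_desc c π)
  have hr : (kernel.ι p ≫ r) ≫ E.g = 0 := by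
    rw [Category.assoc, hpr, kernel.condition_assoc, zero_comp]
  obtain ⟨s, hs⟩ : ∃ s : kernel p ⟶ E.X₁, s ≫ E.f = kernel.ι p ≫ r :=
    ⟨hE.exact.lift _ hr, hE.exact.lift_f _ hr⟩
  obtain ⟨l, hl⟩ : ∃ l : S₀ ⟶ kernel p, l ≫ kernel.ι p = a ≫ biprod.inl :=
    ⟨kernel.lift p (a ≫ biprod.inl) (by simp [p, hac]), kernel.lift_ι _ _ _⟩
  refine ⟨_, hS.prop_kernel p (hS.prop_biprod hS' hT) hS'', l, s, ?_, ?_⟩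
  · rw [← cancel_mono E.f, Category.assoc, hs, reassoc_of% hl]
    simp [r, hab]
  · rw [← cancel_mono (kernel.ι p), Category.assoc, hl, reassoc_of% hfa, zero_comp, zero_comp]

lemma isClosedUnderExtensions_directLimits : (directLimits S).IsClosedUnderExtensions := by
  rw [hS.directLimits_eq]
  exact ⟨fun hE h₁ h₃ ↦ hS.factorsRelations_X₂ hE h₁ h₃⟩

lemma closedUnderKernelsOfEpis_directLimits : ClosedUnderKernelsOfEpis (directLimits S) := by
  rw [hS.directLimits_eq]
  exact fun _ hE h₂ h₃ ↦ hS.factorsRelations_X₁ hE h₂ h₃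

lemma le_directLimits : S ≤ directLimits S := by
  rw [hS.directLimits_eq]
  exact fun _ hX ↦ factorsRelations_of_prop hX

/-- A coproduct is the direct limit of its finite subcoproducts, which are iterated extensions. -/
lemma closedUnderCoproducts_directLimits : ClosedUnderCoproducts (directLimits S) := by
  have : (directLimits S).ContainsZero := by
    obtain ⟨Z, hZ, hSZ⟩ := hS.containsZero.exists_zero
    exact ⟨Z, hZ, hS.le_directLimits _ hSZ⟩
  have := hS.isClosedUnderExtensions_directLimits
  have := isClosedUnderIsomorphisms_of_isClosedUnderExtensions (directLimits S)
  intro I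
  have := hS.closedUnderDirectLimits (Finset (Discrete I))
  refine .mk' ?_
  rintro _ ⟨F, hF⟩
  refine (directLimits S).prop_of_iso
    ((CoproductsFromFiniteFiltered.liftToFinsetColimitCocone F).isColimit.coconePointUniqueUpToIso
      (colimit.isColimit F)) ((directLimits S).prop_colimit
      (CoproductsFromFiniteFiltered.liftToFinsetObj F) fun s ↦ ?_)
  exact prop_sigma_of_finite (directLimits S) _ fun x : s ↦ hF x

lemma isFullyClosed_directLimits : IsFullyClosed (directLimits S) where
  coproducts := hS.closedUnderCoproducts_directLimits
  directLimits := hS.closedUnderDirectLimits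
  extensions := hS.isClosedUnderExtensions_directLimits
  kernelsOfEpis := hS.closedUnderKernelsOfEpis_directLimits

lemma fullClosure_eq_directLimits : fullClosure S = directLimits S := by
  refine le_antisymm (fun X hX ↦ hX _ hS.le_directLimits hS.isFullyClosed_directLimits) ?_
  rintro X ⟨I, _, _, _, hX⟩ P hSP hP
  exact (hP.directLimits I).colimitsOfShape_le _
    (ObjectProperty.colimitsOfShape_monotone I hSP _ hX)

end IsFGResolving

end DirectLimitClasses

theorem propositionB {K : Type u} [Category.{v} K] [Abelian K] [IsGrothendieckAbelian.{v} K] :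
    (∀ S : ObjectProperty K, S.Nonempty →
      (∀ X, S X → IsFinitelyGenerated X) →
      ContainsSetOfGenerators S →
      S.IsClosedUnderExtensions →
      ClosedUnderKernelsOfEpis S →
        ClosedUnderCoproducts (directLimits S) ∧
        ClosedUnderDirectLimits (directLimits S) ∧
        (directLimits S).IsClosedUnderExtensions ∧
        ClosedUnderKernelsOfEpis (directLimits S)) ∧
    (∀ S T : ObjectProperty K, (S ⊔ T).Nonempty →
      (∀ X, T X → ∃ n : ℕ, HasProjectiveDimensionLE X n) →
      ContainsSetOfGenerators (S ⊔ T) →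
      (∀ X, (S ⊔ T) X → IsFinitelyPresentable.{v} X) →
      (S ⊔ T).IsClosedUnderExtensions →
      ClosedUnderKernelsOfEpis (S ⊔ T) →
        fullClosure (S ⊔ T) = directLimits (S ⊔ T)) := by
  refine ⟨fun S hne hfg hgen hext hker ↦ ?_, fun S T hne _ hgen hfp hext hker ↦ ?_⟩
  · have h := (IsFGResolving.mk hne hfg hgen hext hker).isFullyClosed_directLimits
    exact ⟨h.coproducts, h.directLimits, h.extensions, h.kernelsOfEpis⟩
  · exact (IsFGResolving.mk hne
      (fun X hX ↦ isFinitelyGenerated_of_isFinitelyPresentable (hfp X hX)) hgen hext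
      hker).fullClosure_eq_directLimits
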